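/- All graphs are finite and simple. For graphs $G$ and $H$, a copy of $G$ in $H$ is a (not necessarily induced) subgraph of $H$ isomorphic to $G$. Edges are regarded as two-element sets of vertices. For a map $f:E(H)\to E(H)$, a copy $G'$ of $G$ in $H$ is called $f$-exclusive if $f(e)\cap V(G')=\emptyset$ for every $e\in E(G')$. Let $s(n,G)$ be the maximum $m$ for which there exist a graph $H$ with $n$ vertices and $m$ edges and a map $f:E(H)\to E(H)$, with $f(e)\cap e=\emptyset$ for every $e\in E(H)$, such that $H$ contains no $f$-exclusive copy of $G$; let $\mathrm{ex}(n,G)$ be the maximum number of edges of an $n$-vertex graph that contains no copy of $G$. (A maximum over an empty set, which occurs only when $G$ has no edges, is taken to be $0$.) **Theorem.** Let $G$ be a graph. If $\chi(G)\ge 3$, then $s(n,G)=(1+o(1))\,\mathrm{ex}(n,G)$ as $n\to\infty$. If $G$ is bipartite, then $s(n,G)=o(n^2)$ as $n\to\infty$. -/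

import Mathlib

open Filter Asymptotics

namespace EdgeMapping

/-- A mapping `f : E(H) → E(H)` such that `f(e) ∩ e = ∅` for every edge `e` of `H`
(the edges `e` and `f(e)` are regarded as two-element sets of vertices). -/
def IsDisjointing {V : Type*} {H : SimpleGraph V} (f : H.edgeSet → H.edgeSet) : Prop :=
  ∀ e : H.edgeSet, ∀ v : V, v ∈ (e : Sym2 V) → v ∉ (f e : Sym2 V)

/-- A copy `c` of `G` in `H` (a not necessarily induced subgraph of `H`, with vertex set the
range of `c` and with edges the images under `c` of the edges of `G`) is `f`-exclusive if `f(e)`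
contains no vertex of the copy, for every edge `e` of the copy. -/
def IsExclusive {V W : Type*} {G : SimpleGraph W} {H : SimpleGraph V}
    (f : H.edgeSet → H.edgeSet) (c : SimpleGraph.Copy G H) : Prop :=
  ∀ e : G.edgeSet, ∀ w : W, c w ∉ (f (c.mapEdgeSet e) : Sym2 V)

/-- Some mapping `f : E(H) → E(H)` with `f(e) ∩ e = ∅` for all `e` admits no `f`-exclusive copy
of `G` in `H`. -/
def HasAvoidingMap {V W : Type*} (G : SimpleGraph W) (H : SimpleGraph V) : Prop :=
  ∃ f : H.edgeSet → H.edgeSet, IsDisjointing f ∧ ∀ c : SimpleGraph.Copy G H, ¬ IsExclusive f c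

open scoped Classical in
/-- `s(n, G)`: the maximum number of edges of a graph `H` on `n` vertices for which some
`f : E(H) → E(H)` with `f(e) ∩ e = ∅` for all `e` admits no `f`-exclusive copy of `G` in `H`.
If there is no such `H` (which can only happen when `G` has no edges), the value is `0`, as for
`SimpleGraph.extremalNumber`. -/
noncomputable def s (n : ℕ) {W : Type*} (G : SimpleGraph W) : ℕ :=
  Finset.sup {H : SimpleGraph (Fin n) | HasAvoidingMap G H} (fun H => H.edgeFinset.card)

end EdgeMapping

open Filter Asymptotics Topology

/-! ### Turán densities via Erdős–Stone -/

namespace SimpleGraph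

/-! Let `G` be `r`-colorable and place a blow-up of `G` with large parts in a complete `r`-partite
graph in `H`. A random transversal is exclusive with positive probability: for an edge `e` and a
vertex `w` off `e`, the image of `w` is independent of that of `e`, so it hits one of the two ends
of `f e` with probability at most `2 / t`. A union bound finishes, so `s` is at most the extremal
number of that multipartite graph (`s_le_extremalNumber`). Conversely a `G`-free graph with more
than `2 * n` edges has a disjointing map (`extremalNumber_le_s`). By Erdős–Stone both bounds have
the same Turán density when `r` is the chromatic number and `r ≥ 3`; for `r = 2` the upper bound has
density zero. -/

theorem tendsto_choose_two_atTop :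
    Tendsto (fun n : ℕ ↦ (n.choose 2 : ℝ)) atTop atTop := by
  have h : Tendsto (fun n : ℕ ↦ n.choose 2) atTop atTop := by
    refine tendsto_atTop_mono' _ ?_ (tendsto_sub_atTop_nat 1)
    filter_upwards [eventually_ge_atTop 2] with n hn
    rw [Nat.choose_two_right, Nat.le_div_iff_mul_le two_pos, mul_comm]
    exact Nat.mul_le_mul_right _ hn
  exact tendsto_natCast_atTop_atTop.comp h

theorem tendsto_natCast_div_choose_two :
    Tendsto (fun n : ℕ ↦ (n : ℝ) / n.choose 2) atTop (𝓝 0) := by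
  have h : Tendsto (fun n : ℕ ↦ 2 / ((n : ℝ) - 1)) atTop (𝓝 0) :=
    (tendsto_atTop_add_const_right _ (-1) tendsto_natCast_atTop_atTop).const_div_atTop 2
  refine h.congr' ?_
  filter_upwards [eventually_ge_atTop 2] with n hn
  have h2 : (2 : ℝ) ≤ n := by exact_mod_cast hn
  have h1 : (n : ℝ) - 1 ≠ 0 := by linarith
  have h0 : (n : ℝ) ≠ 0 := by linarith
  rw [Nat.cast_choose_two]
  field_simp

/-- If all large graphs with minimum degree at least `c * n` contain `K`, then the extremal number
of `K` grows by less than `c * (n + 1)` from `n` to `n + 1`. -/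
theorem extremalNumber_succ_le_of_minDegree {V : Type*} {K : SimpleGraph V} {c : ℝ} {n : ℕ}
    (hc : 0 ≤ c)
    (h : ∀ {G : SimpleGraph (Fin (n + 1))} [DecidableRel G.Adj],
      G.minDegree ≥ c * (n + 1 : ℕ) → K ⊑ G) :
    (extremalNumber (n + 1) K : ℝ) ≤ extremalNumber n K + c * (n + 1) := by
  conv_lhs => rw [← Fintype.card_fin (n + 1)]
  rw [extremalNumber_le_iff_of_nonneg K (by positivity)]
  intro G _ hG
  have hlt : (G.minDegree : ℝ) < c * (n + 1 : ℕ) := by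
    by_contra! hge
    exact hG (h hge)
  obtain ⟨v, hv⟩ := G.exists_minimal_degree_vertex
  have hdel := card_edgeFinset_deleteIncidenceSet_le_extremalNumber hG v
  rw [card_edgeFinset_deleteIncidenceSet, Fintype.card_fin, Nat.add_sub_cancel, ← hv] at hdel
  have hdel' : (G.edgeFinset.card : ℝ) ≤ extremalNumber n K + G.minDegree := by
    exact_mod_cast Nat.sub_le_iff_le_add.mp hdel
  push_cast at hlt
  linarith

/-- Deleting minimum-degree vertices one at a time and summing the increments gives `c * n.choose 2`
up to a linear error. -/
theorem turanDensity_le_of_minDegree {V : Type*} {K : SimpleGraph V} {c : ℝ} (hc : 0 ≤ c)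
    (h : ∀ᶠ n in atTop, ∀ {G : SimpleGraph (Fin n)} [DecidableRel G.Adj],
      G.minDegree ≥ c * n → K ⊑ G) :
    turanDensity K ≤ c := by
  obtain ⟨N, hN⟩ := eventually_atTop.mp h
  have hsum : ∀ n ≥ N, (extremalNumber n K : ℝ) ≤
      extremalNumber N K + c * (n.choose 2 + n) := by
    intro n hn
    induction n, hn using Nat.le_induction with
    | base => exact le_add_of_nonneg_right (by positivity)
    | succ n hn ih =>
      have hstep := extremalNumber_succ_le_of_minDegree (n := n) hc (hN (n + 1) (by omega))
      have hch : ((n + 1).choose 2 : ℝ) = n + n.choose 2 := by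
        rw [Nat.choose_succ_succ' n 1]
        simp
      rw [hch]
      push_cast
      nlinarith
  have hlim : Tendsto (fun n : ℕ ↦ (extremalNumber N K : ℝ) / n.choose 2 +
      c * (1 + n / n.choose 2)) atTop (𝓝 (0 + c * (1 + 0))) :=
    (tendsto_choose_two_atTop.const_div_atTop _).add
      ((tendsto_natCast_div_choose_two.const_add 1).const_mul c)
  rw [add_zero, mul_one, zero_add] at hlim
  refine le_of_tendsto_of_tendsto (tendsto_turanDensity K) hlim ?_
  filter_upwards [eventually_ge_atTop N, eventually_ge_atTop 2] with n hn h2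
  have hpos : (0 : ℝ) < n.choose 2 := by exact_mod_cast Nat.choose_pos h2
  rw [div_le_iff₀ hpos]
  refine (hsum n hn).trans_eq ?_
  field_simp

/-- The **Erdős–Stone theorem**, upper bound on the Turán density. -/
theorem turanDensity_completeEquipartiteGraph_le {r : ℕ} (hr : 0 < r) (t : ℕ) :
    turanDensity (completeEquipartiteGraph (r + 1) t) ≤ 1 - 1 / r := by
  refine le_of_forall_pos_le_add fun ε hε ↦ turanDensity_le_of_minDegree ?_
    (eventually_completeEquipartiteGraph_isContained_of_minDegree hε r t)
  have h1 : (1 : ℝ) ≤ r := by exact_mod_cast hr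
  have : 1 / (r : ℝ) ≤ 1 := by rw [div_le_one (by positivity)]; exact h1
  linarith

/-- Complete `r`-partite graphs are `G`-free. Since the density is a limit, the orders `r * t`
suffice. -/
theorem le_turanDensity_of_not_colorable {W : Type*} {G : SimpleGraph W} {r : ℕ} (hr : 0 < r)
    (hG : ¬ G.Colorable r) : 1 - 1 / (r : ℝ) ≤ turanDensity G := by
  have hmul : Tendsto (fun t : ℕ ↦ r * t) atTop atTop :=
    tendsto_id.const_mul_atTop' hr
  refine ge_of_tendsto ((tendsto_turanDensity G).comp hmul) ?_
  filter_upwards [eventually_ge_atTop 2] with t ht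
  have hfree : G.Free (completeEquipartiteGraph r t) := by
    rintro ⟨c⟩
    exact hG ⟨(Coloring.mk (α := Fin r) Prod.fst fun h ↦ h).comp c.toHom⟩
  have hle := card_edgeFinset_le_extremalNumber hfree
  rw [card_edgeFinset_completeEquipartiteGraph, Fintype.card_prod, Fintype.card_fin,
    Fintype.card_fin] at hle
  have hle' : ((r.choose 2 * t ^ 2 : ℕ) : ℝ) ≤ extremalNumber (r * t) G := by exact_mod_cast hle
  have hr1 : (1 : ℝ) ≤ r := by exact_mod_cast hr
  have ht2 : (2 : ℝ) ≤ t := by exact_mod_cast ht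
  have hpos : (0 : ℝ) < (r * t).choose 2 := by
    exact_mod_cast Nat.choose_pos (ht.trans (Nat.le_mul_of_pos_left t hr))
  simp only [Function.comp_apply]
  rw [le_div_iff₀ hpos]
  refine le_trans ?_ hle'
  push_cast
  rw [Nat.cast_choose_two, Nat.cast_choose_two]
  push_cast
  have hr0 : (r : ℝ) ≠ 0 := by linarith
  have heq : (1 - 1 / (r : ℝ)) * (r * t * (r * t - 1) / 2) = (r - 1) * t * (r * t - 1) / 2 := by
    field_simp
  rw [heq]
  have : 0 ≤ ((r : ℝ) - 1) * t := mul_nonneg (by linarith) (by linarith)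
  nlinarith

end SimpleGraph

/-! ### Exclusive copies and bounds on `s` -/

namespace EdgeMapping

open SimpleGraph

/-- In a blow-up of `G`, each vertex `w` of `G` can be sent to any of `t` vertices `ι w x`. If all
these choices give copies, then some choice gives an exclusive copy. -/
theorem exists_isExclusive_of_transversals {V W : Type*} [Fintype W] {G : SimpleGraph W}
    {H : SimpleGraph V} {f : H.edgeSet → H.edgeSet} (hf : IsDisjointing f) {t : ℕ}
    (ht : 2 * (Nat.card G.edgeSet * Nat.card W) < t) (ι : W → Fin t → V)
    (hι : ∀ w, Function.Injective (ι w)) (c : (W → Fin t) → Copy G H)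
    (hc : ∀ x w, c x w = ι w (x w)) : ∃ x, IsExclusive f (c x) := by
  classical
  by_contra! hbad
  have htpos : 0 < t := by omega
  let B : G.edgeSet × W → Finset (W → Fin t) := fun p ↦
    {x | c x p.2 ∈ (f ((c x).mapEdgeSet p.1) : Sym2 V)}
  have hcover : (Finset.univ : Finset (W → Fin t)) ⊆ Finset.univ.biUnion B := by
    intro x _
    have := hbad x
    simp only [IsExclusive, not_forall, not_not] at this
    obtain ⟨e, w, h⟩ := this
    exact Finset.mem_biUnion.mpr ⟨(e, w), Finset.mem_univ _, by simpa [B] using h⟩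
  have hB : ∀ p, (B p).card * t ≤ 2 * t ^ Fintype.card W := by
    rintro ⟨e, w⟩
    by_cases hw : w ∈ (e : Sym2 W)
    · have : B (e, w) = ∅ := by
        refine Finset.filter_eq_empty_iff.mpr fun x _ ↦ hf _ _ ?_
        exact Sym2.mem_map.mpr ⟨w, hw, rfl⟩
      simp [this]
    · let z : Fin t := ⟨0, htpos⟩
      have hsame : ∀ x a, (c (Function.update x w a)).mapEdgeSet e = (c x).mapEdgeSet e := by
        intro x a
        apply Subtype.ext
        refine Sym2.map_congr fun v hv ↦ ?_
        have hvw : v ≠ w := fun h ↦ hw (h ▸ hv)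
        change c _ v = c x v
        rw [hc, hc, Function.update_of_ne hvw]
      -- Resample coordinate `w`. Over a given `y` only the old value `x w` is unknown, and it must
      -- name one of the two ends of an edge determined by `y`.
      have hinj : ((B (e, w)) ×ˢ (Finset.univ : Finset (Fin t))).card ≤
          2 * (Finset.univ : Finset (W → Fin t)).card := by
        refine Finset.card_le_mul_card_image_of_maps_to
          (f := fun q ↦ Function.update q.1 w q.2) (fun _ _ ↦ Finset.mem_univ _) 2 ?_
        intro y _
        have hmaps : ∀ q ∈ ((B (e, w)) ×ˢ (Finset.univ : Finset (Fin t))).filter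
            (fun q ↦ Function.update q.1 w q.2 = y),
            ι w (q.1 w) ∈ (f ((c y).mapEdgeSet e) : Sym2 V).toFinset := by
          rintro ⟨x, a⟩ hq
          simp only [Finset.mem_filter, Finset.mem_product, Finset.mem_univ, and_true, B,
            true_and] at hq
          obtain ⟨h1, rfl⟩ := hq
          rw [Sym2.mem_toFinset, hsame, ← hc]
          exact h1
        refine (Finset.card_le_card_of_injOn _ hmaps ?_).trans ?_
        · rintro ⟨x, a⟩ hx ⟨x', a'⟩ hx' heq
          have hxw : x w = x' w := hι w heq
          simp only [Finset.coe_filter, Set.mem_ofPred_eq] at hx hx'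
          have h := hx.2.trans hx'.2.symm
          have ha : a = a' := by simpa using congrFun h w
          have hxx : x = x' := by
            funext v
            by_cases hv : v = w
            · rw [hv, hxw]
            · simpa [hv] using congrFun h v
          rw [ha, hxx]
        · rw [Sym2.card_toFinset]
          split_ifs <;> omega
      simpa using hinj
  have hcard : t ^ Fintype.card W ≤ ∑ p, (B p).card := by
    simpa using (Finset.card_le_card hcover).trans Finset.card_biUnion_le
  have hmul : t ^ Fintype.card W * t ≤
      Nat.card G.edgeSet * Nat.card W * (2 * t ^ Fintype.card W) := by
    calc t ^ Fintype.card W * t ≤ (∑ p, (B p).card) * t := Nat.mul_le_mul_right _ hcard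
      _ = ∑ p, (B p).card * t := Finset.sum_mul _ _ _
      _ ≤ ∑ _p : G.edgeSet × W, 2 * t ^ Fintype.card W := Finset.sum_le_sum fun p _ ↦ hB p
      _ = _ := by
        rw [Finset.sum_const, Finset.card_univ, smul_eq_mul, ← Nat.card_eq_fintype_card,
          Nat.card_prod]
  have hpow : 0 < t ^ Fintype.card W := Nat.pow_pos htpos
  nlinarith

/-- The size of the parts of a complete equipartite graph that suffices to find an exclusive copy
of `G` in it. -/
noncomputable def partSize {W : Type*} (G : SimpleGraph W) : ℕ :=
  Nat.card W * (2 * (Nat.card G.edgeSet * Nat.card W) + 1)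

theorem free_of_hasAvoidingMap {V W : Type*} [Finite W] {G : SimpleGraph W} {H : SimpleGraph V}
    {r : ℕ} (hG : G.Colorable r) (h : HasAvoidingMap G H) :
    (completeEquipartiteGraph r (partSize G)).Free H := by
  rintro ⟨k⟩
  obtain ⟨f, hf, hcopy⟩ := h
  obtain ⟨C⟩ := hG
  have := Fintype.ofFinite W
  set t := 2 * (Nat.card G.edgeSet * Nat.card W) + 1 with ht
  -- Each part splits into `Nat.card W` blocks of size `t`; `w` uses its own block in the part of
  -- its color.
  let ι : W → Fin t → Fin r × Fin (partSize G) := fun w a ↦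
    (C w, finProdFinEquiv (Finite.equivFin W w, a))
  have hι : ∀ w w' a a', ι w a = ι w' a' → w = w' ∧ a = a' := by
    intro w w' a a' h
    have h' := Prod.ext_iff.mp (finProdFinEquiv.injective (Prod.ext_iff.mp h).2)
    exact ⟨(Finite.equivFin W).injective h'.1, h'.2⟩
  let c : (W → Fin t) → Copy G H := fun x ↦ k.comp
    ⟨⟨fun w ↦ ι w (x w), fun {v w} h ↦ C.valid h⟩, fun v w h ↦ (hι _ _ _ _ h).1⟩
  obtain ⟨x, hx⟩ := exists_isExclusive_of_transversals hf (t := t) (by omega)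
    (fun w a ↦ k (ι w a)) (fun w a a' h ↦ (hι _ _ _ _ (k.injective h)).2) c
    (fun _ _ ↦ rfl)
  exact hcopy _ hx

theorem s_le_extremalNumber {W : Type*} [Finite W] {G : SimpleGraph W} {r : ℕ}
    (hG : G.Colorable r) (n : ℕ) :
    s n G ≤ extremalNumber n (completeEquipartiteGraph r (partSize G)) := by
  classical
  refine Finset.sup_le fun H hH ↦ ?_
  have := card_edgeFinset_le_extremalNumber
    (free_of_hasAvoidingMap hG (Finset.mem_filter.mp hH).2)
  rw [Fintype.card_fin] at this
  convert this

/-- The edges meeting a given edge lie in two stars, so they number fewer than `2 * n`. -/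
theorem exists_isDisjointing {n : ℕ} {H : SimpleGraph (Fin n)} [DecidableRel H.Adj]
    (h : 2 * n < H.edgeFinset.card) : ∃ f : H.edgeSet → H.edgeSet, IsDisjointing f := by
  classical
  suffices ∀ e : H.edgeSet, ∃ e' : H.edgeSet, ∀ v, v ∈ (e : Sym2 (Fin n)) →
      v ∉ (e' : Sym2 (Fin n)) by
    choose f hf using this
    exact ⟨f, hf⟩
  rintro ⟨e, he⟩
  induction e with
  | _ a b =>
  by_contra! hall
  have hsub : H.edgeFinset ⊆ H.incidenceFinset a ∪ H.incidenceFinset b := by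
    intro e' he'
    obtain ⟨v, hv, hv'⟩ := hall ⟨e', mem_edgeFinset.mp he'⟩
    rw [Finset.mem_union, mem_incidenceFinset, mem_incidenceFinset]
    rcases Sym2.mem_iff.mp hv with rfl | rfl
    · exact Or.inl ⟨mem_edgeFinset.mp he', hv'⟩
    · exact Or.inr ⟨mem_edgeFinset.mp he', hv'⟩
  have h1 := (Finset.card_le_card hsub).trans (Finset.card_union_le _ _)
  rw [card_incidenceFinset_eq_degree, card_incidenceFinset_eq_degree] at h1
  have ha := H.degree_lt_card_verts a
  have hb := H.degree_lt_card_verts b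
  rw [Fintype.card_fin] at ha hb
  omega

theorem extremalNumber_le_s {W : Type*} {G : SimpleGraph W} {n : ℕ}
    (h : 2 * n < extremalNumber n G) : extremalNumber n G ≤ s n G := by
  classical
  obtain ⟨H, _, hH, hcard⟩ := (lt_extremalNumber_iff (V := Fin n) G (extremalNumber n G - 1)).mp
    (by rw [Fintype.card_fin]; omega)
  obtain ⟨f, hf⟩ := exists_isDisjointing (H := H) (by omega)
  have hmem : H ∈ ({H : SimpleGraph (Fin n) | HasAvoidingMap G H} : Finset _) :=
    Finset.mem_filter.mpr ⟨Finset.mem_univ _, f, hf, fun c ↦ absurd ⟨c⟩ hH⟩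
  have hle : H.edgeFinset.card ≤ s n G := by
    have := Finset.le_sup (f := fun H : SimpleGraph (Fin n) ↦ H.edgeFinset.card) hmem
    unfold s
    convert! this
  omega

theorem eventually_extremalNumber_le_s {W : Type*} {G : SimpleGraph W}
    (hG : 0 < turanDensity G) : ∀ᶠ n in atTop, extremalNumber n G ≤ s n G := by
  have h2 : Tendsto (fun n : ℕ ↦ 2 * ((n : ℝ) / n.choose 2)) atTop (𝓝 (2 * 0)) :=
    tendsto_natCast_div_choose_two.const_mul 2
  rw [mul_zero] at h2
  filter_upwards [h2.eventually_lt (tendsto_turanDensity G) hG, eventually_ge_atTop 2]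
    with n hn hn2
  apply extremalNumber_le_s
  have hpos : (0 : ℝ) < n.choose 2 := by exact_mod_cast Nat.choose_pos hn2
  rw [← mul_div_assoc, div_lt_div_iff_of_pos_right hpos] at hn
  exact_mod_cast hn

theorem s_isEquivalent_extremalNumber {W : Type*} [Finite W] {G : SimpleGraph W} {r : ℕ}
    (hr : 2 ≤ r) (hcol : G.Colorable (r + 1)) (hnot : ¬ G.Colorable r) :
    (fun n : ℕ ↦ (s n G : ℝ)) ~[atTop] (fun n : ℕ ↦ (extremalNumber n G : ℝ)) := by
  set K := completeEquipartiteGraph (r + 1) (partSize G)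
  have hlow := le_turanDensity_of_not_colorable (by omega : 0 < r) hnot
  have hr2 : (2 : ℝ) ≤ r := by exact_mod_cast hr
  have hinv : 1 / (r : ℝ) < 1 := by rw [div_lt_one (by linarith)]; linarith
  have hpos : 0 < turanDensity G := by linarith
  have hev := eventually_extremalNumber_le_s hpos
  -- Erdős–Stone gives `≤`; the sandwich of `s` between the two extremal numbers gives `≥`.
  have hKG : turanDensity K = turanDensity G := by
    refine le_antisymm
      ((turanDensity_completeEquipartiteGraph_le (by omega : 0 < r) _).trans hlow) ?_
    refine le_of_tendsto_of_tendsto (tendsto_turanDensity G) (tendsto_turanDensity K) ?_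
    filter_upwards [hev] with n hn
    gcongr
    exact hn.trans (s_le_extremalNumber hcol n)
  have hlim : Tendsto (fun n : ℕ ↦ (s n G / n.choose 2 : ℝ)) atTop (𝓝 (turanDensity G)) := by
    refine tendsto_of_tendsto_of_tendsto_of_le_of_le' (tendsto_turanDensity G)
      (hKG ▸ tendsto_turanDensity K) ?_ ?_
    · filter_upwards [hev] with n hn
      gcongr
    · filter_upwards with n
      gcongr
      exact s_le_extremalNumber hcol n
  have hne : ∀ᶠ n : ℕ in atTop, (extremalNumber n G : ℝ) ≠ 0 := by
    filter_upwards [(tendsto_turanDensity G).eventually_const_lt hpos] with n hn h0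
    simp [h0] at hn
  rw [isEquivalent_iff_tendsto_one hne]
  have hdiv := hlim.div (tendsto_turanDensity G) hpos.ne'
  rw [div_self hpos.ne'] at hdiv
  refine hdiv.congr' ?_
  filter_upwards [eventually_ge_atTop 2] with n hn
  have hc : (n.choose 2 : ℝ) ≠ 0 := by exact_mod_cast (Nat.choose_pos hn).ne'
  exact div_div_div_cancel_right₀ hc _ _

theorem s_isLittleO_of_isBipartite {W : Type*} [Finite W] {G : SimpleGraph W}
    (hG : G.IsBipartite) :
    (fun n : ℕ ↦ (s n G : ℝ)) =o[atTop] (fun n : ℕ ↦ (n : ℝ) ^ 2) := by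
  set K := completeEquipartiteGraph 2 (partSize G)
  have hK : turanDensity K = 0 := by
    refine le_antisymm ?_ (ge_of_tendsto' (tendsto_turanDensity K) fun n ↦ by positivity)
    simpa using turanDensity_completeEquipartiteGraph_le one_pos (partSize G)
  have hlim : Tendsto (fun n : ℕ ↦ (extremalNumber n K / n.choose 2 : ℝ)) atTop (𝓝 0) :=
    hK ▸ tendsto_turanDensity K
  have hne : ∀ᶠ n : ℕ in atTop, (n : ℝ) ^ 2 = 0 → (s n G : ℝ) = 0 := by
    filter_upwards [eventually_ge_atTop 1] with n hn h
    simp at h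
    omega
  rw [isLittleO_iff_tendsto' hne]
  refine squeeze_zero' (.of_forall fun n ↦ by positivity) ?_ hlim
  filter_upwards [eventually_ge_atTop 2] with n hn
  have hpos : (0 : ℝ) < n.choose 2 := by exact_mod_cast Nat.choose_pos hn
  refine div_le_div₀ (by positivity) (by exact_mod_cast s_le_extremalNumber hG n) hpos ?_
  exact_mod_cast Nat.choose_le_pow n 2

end EdgeMapping

theorem mainTheorem10 {W : Type*} [Finite W] (G : SimpleGraph W) :
    (3 ≤ G.chromaticNumber →
      (fun n : ℕ => (EdgeMapping.s n G : ℝ)) ~[atTop]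
        (fun n : ℕ => (SimpleGraph.extremalNumber n G : ℝ))) ∧
    (G.IsBipartite →
      (fun n : ℕ => (EdgeMapping.s n G : ℝ)) =o[atTop] (fun n : ℕ => (n : ℝ) ^ 2)) := by
  refine ⟨fun h3 ↦ ?_, EdgeMapping.s_isLittleO_of_isBipartite⟩
  have := Fintype.ofFinite W
  obtain ⟨m, hm⟩ := ENat.ne_top_iff_exists.mp
    (SimpleGraph.chromaticNumber_ne_top_iff_exists.mpr ⟨_, G.colorable_of_fintype⟩)
  have hm3 : 3 ≤ m := by rw [← hm] at h3; exact_mod_cast h3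
  obtain ⟨r, rfl⟩ : ∃ r, m = r + 1 := ⟨m - 1, by omega⟩
  refine EdgeMapping.s_isEquivalent_extremalNumber (r := r) (by omega)
    (SimpleGraph.chromaticNumber_le_iff_colorable.mp hm.ge) fun hcol ↦ ?_
  have hle := SimpleGraph.chromaticNumber_le_iff_colorable.mpr hcol
  rw [← hm] at hle
  have : r + 1 ≤ r := by exact_mod_cast hle
  omega
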